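/- Let $n\in\mathbb{N}$, $n\ge 1$, and $\beta\in\,]0,1[$. For $p\in[0,1]^n$ let $\bar p=\frac1n\sum_{j=1}^n p_j$ and let $\mathrm{BC}_p=\mathrm{B}_{p_1}*\dots*\mathrm{B}_{p_n}$ be the Bernoulli convolution (Poisson-binomial law), where $\mathrm{B}_q$ is the Bernoulli law with success probability $q$; let $\mathrm{B}_{m,q}$ denote the binomial law. A set $J\subseteq[0,1]$ is an *upray* if $x\in J$, $y\in[0,1]$, $x\le y$ imply $y\in J$. A *$\beta$-confidence upray* (for $\bar p$) is a function $K:\{0,\dots,n\}\to2^{[0,1]}$ whose values are uprays and which satisfies $\mathrm{BC}_p(\{x: \bar p\in K(x)\})\ge\beta$ for every $p\in[0,1]^n$. It is *isotone* if $K(x)\supseteq K(y)$ whenever $x<y$, and *strictly isotone* if $K(x)\supsetneq K(y)$ whenever $x<y$. An isotone $\beta$-confidence upray $K$ is *(Buehler-)optimal* if $K(x)\subseteq K^*(x)$ for all $x$ and every isotone $\beta$-confidence upray $K^*$. A $\beta$-confidence upray $K$ is *admissible* among all $\beta$-confidence uprays if every $\beta$-confidence upray $K^*$ with $K^*(x)\subseteq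 K(x)$ for all $x$ equals $K$. For $1\le x\le m$ let $g_m(x)$ be the unique $q\in[0,1]$ with $\mathrm{B}_{m,q}(\{x,\dots,m\})=1-\beta$, and for $m\ge0$ let $K_{\mathrm{CP},m}(0)=[0,1]$ and $K_{\mathrm{CP},m}(x)=\,]g_m(x),1]$ for $x\in\{1,\dots,m\}$ (the Clopper-Pearson uprays). Define $$K(x)=\bigcup_{l\in\{0,\dots,x\}}\ \bigcup_{m\in\{x-l,\dots,n-l\}}\Bigl(\tfrac mn K_{\mathrm{CP},m}(x-l)+\tfrac ln\Bigr)\qquad\text{for }x\in\{0,\dots,n\}.$$ Then $K$ is the optimal isotone $\beta$-confidence upray, is admissible among all $\beta$-confidence uprays, is strictly isotone, and has effective level $\inf_{p\in[0,1]^n}\mathrm{BC}_p(\{x:\bar p\in K(x)\})=\beta$. Moreover $K(0)=[0,1]$, $K(1)=\,\bigl]\frac{1-\beta}{n},1\bigr]$, and, if $\beta\ge\beta_n:=\mathrm{B}_{n,1/n}(\{0,1\})$, then $K(x)=\,]g_n(x),1]$ for every $x\in\{2,\dots,n\}$. -/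

import Mathlib

open MeasureTheory ProbabilityTheory
open scoped unitInterval

namespace BernoulliChain

/-- The Bernoulli convolution (Poisson-binomial law) `Ber(p 0) ∗ ⋯ ∗ Ber(p (n - 1))` on `ℕ`; the
empty convolution is the Dirac measure at `0`. -/
noncomputable def bernoulliConv : {n : ℕ} → (Fin n → I) → Measure ℕ
  | 0, _ => Measure.dirac 0
  | _ + 1, p =>
      Measure.conv (bernoulliMeasure (1 : ℕ) 0 (p 0)) (bernoulliConv (fun j => p j.succ))

/-- The average success probability of a Bernoulli chain. -/
noncomputable def avg {n : ℕ} (p : Fin n → I) : ℝ := (1 / (n : ℝ)) * ∑ j, (p j : ℝ)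

/-- The probability, under the Bernoulli convolution with parameter `p`, that the region `K`
contains the average success probability. -/
noncomputable def coverage {n : ℕ} (K : Fin (n + 1) → Set ℝ) (p : Fin n → I) : ℝ :=
  (bernoulliConv p).real {k : ℕ | ∃ x : Fin (n + 1), (x : ℕ) = k ∧ avg p ∈ K x}

/-- `K : {0, …, n} → 2^[0,1]` is a `β`-confidence region for the average success probability of a
Bernoulli chain of length `n`. -/
def IsConfidenceRegion (β : ℝ) {n : ℕ} (K : Fin (n + 1) → Set ℝ) : Prop :=
  (∀ x, K x ⊆ Set.Icc 0 1) ∧ ∀ p : Fin n → I, β ≤ coverage K p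

/-- `J` is an upray in `[0,1]`. -/
def IsUpray (J : Set ℝ) : Prop :=
  J ⊆ Set.Icc 0 1 ∧ ∀ x ∈ J, ∀ y ∈ Set.Icc (0 : ℝ) 1, x ≤ y → y ∈ J

/-- `K` is a `β`-confidence upray: a `β`-confidence region all of whose values are uprays. -/
def IsConfidenceUpray (β : ℝ) {n : ℕ} (K : Fin (n + 1) → Set ℝ) : Prop :=
  IsConfidenceRegion β K ∧ ∀ x, IsUpray (K x)

/-- Isotonicity with respect to reverse inclusion. -/
def IsIsotone {n : ℕ} (K : Fin (n + 1) → Set ℝ) : Prop :=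
  ∀ x y, x < y → K y ⊆ K x

/-- Strict isotonicity with respect to reverse inclusion. -/
def IsStrictlyIsotone {n : ℕ} (K : Fin (n + 1) → Set ℝ) : Prop :=
  ∀ x y, x < y → K y ⊂ K x

/-- `K` is the (Buehler-)optimal isotone `β`-confidence upray. -/
def IsOptimalIsotone (β : ℝ) {n : ℕ} (K : Fin (n + 1) → Set ℝ) : Prop :=
  IsConfidenceUpray β K ∧ IsIsotone K ∧
    ∀ K' : Fin (n + 1) → Set ℝ, IsConfidenceUpray β K' → IsIsotone K' → ∀ x, K x ⊆ K' x

/-- `K` is admissible in the set of all `β`-confidence uprays. -/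
def IsAdmissible (β : ℝ) {n : ℕ} (K : Fin (n + 1) → Set ℝ) : Prop :=
  IsConfidenceUpray β K ∧
    ∀ K' : Fin (n + 1) → Set ℝ, IsConfidenceUpray β K' → (∀ x, K' x ⊆ K x) → K' = K

/-- The Clopper-Pearson bound: the `p ∈ [0,1]` with `B_{n,p}({x, …, n}) = 1 - β`. It is used for
`1 ≤ x ≤ n` and `0 < β < 1` only, where this `p` exists and is unique
(see `clopperPearsonBound_spec`). -/
noncomputable def clopperPearsonBound (β : ℝ) (n x : ℕ) : I :=
  Classical.epsilon fun p : I => (binomial n p).real (Set.Icc x n) = 1 - β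

/-- The Clopper-Pearson uprays. -/
noncomputable def clopperPearsonUpray (β : ℝ) (n : ℕ) (x : Fin (n + 1)) : Set ℝ :=
  if (x : ℕ) = 0 then Set.Icc 0 1 else Set.Ioc (clopperPearsonBound β n x : ℝ) 1

/-- The region `K(x) = ⋃ ((m/n) K'_m(x - l) + l/n)`, the union being over `l ∈ {0, …, x}` and
`m ∈ {x - l, …, n - l}`, built from regions `K'_m : {0, …, m} → 2^[0,1]`. -/
noncomputable def chainRegion (K' : (m : ℕ) → Fin (m + 1) → Set ℝ) (n : ℕ) (x : Fin (n + 1)) :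
    Set ℝ :=
  ⋃ (l : ℕ) (_ : l ≤ (x : ℕ)) (m : ℕ) (hm : (x : ℕ) - l ≤ m) (_ : m ≤ n - l),
    (fun t : ℝ => (m : ℝ) / n * t + (l : ℝ) / n) '' K' m ⟨(x : ℕ) - l, Nat.lt_succ_of_le hm⟩

/-- The region `chainRegion` built from the Clopper-Pearson uprays. -/
noncomputable def optimalUpray (β : ℝ) (n : ℕ) : Fin (n + 1) → Set ℝ :=
  chainRegion (clopperPearsonUpray β) n

/-- `β_n = B_{n,1/n}({0,1})`. -/
noncomputable def betaThreshold (n : ℕ) : ℝ :=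
  (binomial n ⟨(n : ℝ)⁻¹, inv_nonneg.2 n.cast_nonneg, Nat.cast_inv_le_one n⟩).real {0, 1}

theorem binomial_tail_eq (n x : ℕ) (p : I) :
    (binomial n p).real (Set.Icc x n) =
      (∑ k ∈ Finset.Icc x n, bernsteinPolynomial ℝ n k).eval (p : ℝ) := by
  rw [← Finset.coe_Icc, ← sum_measureReal_singleton, Polynomial.eval_finsetSum]
  refine Finset.sum_congr rfl fun k _ => ?_
  rw [binomial_real_singleton]
  simp [bernsteinPolynomial]

theorem derivative_tail (n x : ℕ) (hxn : x ≤ n) :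
    Polynomial.derivative (∑ k ∈ Finset.Icc (x + 1) (n + 1), bernsteinPolynomial ℝ (n + 1) k) =
      ((n + 1 : ℕ) : Polynomial ℝ) * bernsteinPolynomial ℝ n x := by
  rw [← Finset.Ico_add_one_right_eq_Icc, ← Finset.sum_Ico_add' _ x (n + 1) 1, Polynomial.derivative_sum]
  simp_rw [bernsteinPolynomial.derivative_succ]
  rw [← Finset.mul_sum, Nat.add_sub_cancel]
  have := Finset.sum_Ico_sub (fun k => bernsteinPolynomial ℝ n k) (Nat.le_succ_of_le hxn)
  have h2 : ∑ k ∈ Finset.Ico x (n + 1),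
      (bernsteinPolynomial ℝ n k - bernsteinPolynomial ℝ n (k + 1)) = bernsteinPolynomial ℝ n x := by
    have h3 : bernsteinPolynomial ℝ n (n + 1) = 0 :=
      bernsteinPolynomial.eq_zero_of_lt ℝ (Nat.lt_succ_self n)
    rw [h3, zero_sub] at this
    rw [← neg_inj, ← this, ← Finset.sum_neg_distrib]
    exact Finset.sum_congr rfl fun k _ => by ring
  rw [h2]

/-- For `1 ≤ x ≤ n` and `0 < β < 1` the equation defining the Clopper-Pearson bound has exactly one
solution in `[0,1]`. -/
theorem existsUnique_binomial_tail {β : ℝ} (hβ : β ∈ Set.Ioo (0 : ℝ) 1) {n x : ℕ} (hx : 1 ≤ x)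
    (hxn : x ≤ n) : ∃! p : I, (binomial n p).real (Set.Icc x n) = 1 - β := by
  obtain ⟨x, rfl⟩ := Nat.exists_eq_add_of_le' hx
  obtain ⟨n, rfl⟩ := Nat.exists_eq_add_of_le' (hx.trans hxn)
  have hxn' : x ≤ n := by omega
  set P := ∑ k ∈ Finset.Icc (x + 1) (n + 1), bernsteinPolynomial ℝ (n + 1) k with hP
  have hmono : StrictMonoOn (fun t : ℝ => P.eval t) (Set.Icc 0 1) := by
    refine strictMonoOn_of_deriv_pos (convex_Icc 0 1) P.continuous.continuousOn fun t ht => ?_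
    rw [interior_Icc] at ht
    have h1 : 0 < 1 - t := by linarith [ht.2]
    have h0 : 0 < t := ht.1
    have hc : 0 < (n.choose x : ℝ) := by exact_mod_cast Nat.choose_pos hxn'
    rw [Polynomial.deriv, hP, derivative_tail n x hxn']
    simp only [bernsteinPolynomial, Polynomial.eval_mul, Polynomial.eval_natCast,
      Polynomial.eval_pow, Polynomial.eval_X, Polynomial.eval_sub, Polynomial.eval_one]
    positivity
  have e0 : P.eval 0 = 0 := by
    rw [hP, Polynomial.eval_finsetSum]
    refine Finset.sum_eq_zero fun k hk => ?_
    rw [bernsteinPolynomial.eval_at_0, if_neg]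
    have := (Finset.mem_Icc.1 hk).1
    omega
  have e1 : P.eval 1 = 1 := by
    rw [hP, Polynomial.eval_finsetSum, Finset.sum_eq_single (n + 1)]
    · simp [bernsteinPolynomial.eval_at_1]
    · intro k _ hk
      rw [bernsteinPolynomial.eval_at_1, if_neg hk]
    · intro h
      exact absurd (Finset.mem_Icc.2 ⟨hxn, le_rfl⟩) h
  have hivt := intermediate_value_Icc (zero_le_one' ℝ) (f := fun t : ℝ => P.eval t)
    P.continuous.continuousOn
  simp only [e0, e1] at hivt
  obtain ⟨t, ht, hte⟩ := hivt (show 1 - β ∈ Set.Icc (0 : ℝ) 1 from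
    ⟨by linarith [hβ.2], by linarith [hβ.1]⟩)
  refine ⟨⟨t, ht⟩, ?_, fun q hq => ?_⟩
  · simp only [binomial_tail_eq]
    exact hte
  · simp only [binomial_tail_eq] at hq
    exact Subtype.ext (hmono.injOn q.2 ht (hq.trans hte.symm))

theorem clopperPearsonBound_spec {β : ℝ} (hβ : β ∈ Set.Ioo (0 : ℝ) 1) {n x : ℕ} (hx : 1 ≤ x)
    (hxn : x ≤ n) :
    (binomial n (clopperPearsonBound β n x)).real (Set.Icc x n) = 1 - β :=
  Classical.epsilon_spec (existsUnique_binomial_tail hβ hx hxn).exists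

end BernoulliChain

open BernoulliChain

/-! The proof rests on one description of the region: `optimalUpray β n x` is the set of the
averages `avg p` of those parameters `p` for which `BC_p({x, …, n}) > 1 - β`
(`mem_optimalUpray_iff_exists_param`). The pieces in the definition of the region account for the
parameters made of `l` ones, `m` equal entries and zeros; that these suffice is Hoeffding's
theorem (`exists_shifted_binomial_ge`): the expectation of a function of the number of successes
is, for a fixed sum of the success probabilities, affine in the product of any two of them, so
that some maximizer has at most one value other than `0` and `1`.

From this description the statistical claims follow. If `avg p` is not in `optimalUpray β n x`,
then `BC_p({0, …, x - 1}) ≥ β`, and applied to the first such `x` this is the confidence property.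
Conversely, if `avg p` is in `optimalUpray β n x` because of `p`, a confidence region that omits
`avg p` at each observation in `{x, …, n}` has coverage less than `β` at `p`
(`exists_mem_of_mem_optimalUpray`), which gives optimality and, by strict isotonicity,
admissibility. For `x ≥ 1` the region is a half-open interval whose lower endpoint is the average
of a parameter `p` with `BC_p({x, …, n}) = 1 - β` exactly (`optimalUpray_eq_Ioc`). This endpoint
separates consecutive values of the region, and for `x = 1` it shows that the level `β` is
attained.

The interval for `x = 1` comes from Bernoulli's inequality. For `x ≥ 2` and `β ≥ β_n` the binomial
parameter is the extremal one. If the mean of the number of successes is at most `x - 1`, this is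
Hoeffding's inequality (`tailProb_chainPoly_le`): averaging two distinct entries of an extremal
parameter would not decrease the tail, because a shifted binomial law is nonincreasing beyond its
mean. For a larger mean, it suffices that the binomial law with mean `k = x - 1` gives `{0, …, k}`
probability at most `β_n` (`one_sub_betaThreshold_le_tailProb`). By Hoeffding's inequality this
probability is nonincreasing in `n`; for `k ≥ 2` it is therefore at most its value `1 - (1 - 1 /
(k + 1)) ^ (k + 1)` at `n = k + 1`, hence at most `19 / 27 ≤ β_n`.

Laws on `ℕ` are handled through their generating polynomials, in which the order of the trials is
irrelevant and single trials can be split off as factors. -/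

namespace BernoulliChain

open Polynomial

/-! ### Probability generating polynomials -/

/-- The expectation of `f` under the law with generating polynomial `P`, that is
`∑ k, P.coeff k * f k`. -/
noncomputable def expect (f : ℕ → ℝ) : ℝ[X] →ₗ[ℝ] ℝ :=
  lsum fun k => f k • LinearMap.id

theorem expect_eq_sum_range (f : ℕ → ℝ) (P : ℝ[X]) {N : ℕ} (hN : P.natDegree < N) :
    expect f P = ∑ k ∈ Finset.range N, f k * P.coeff k := by
  simp only [expect, lsum_apply, LinearMap.smul_apply, LinearMap.id_apply, smul_eq_mul]
  exact P.sum_over_range' (by simp) N hN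

theorem expect_monomial (f : ℕ → ℝ) (k : ℕ) (a : ℝ) : expect f (monomial k a) = f k * a := by
  simp [expect, lsum_apply]

theorem expect_one (f : ℕ → ℝ) : expect f 1 = f 0 := by
  simpa using expect_monomial f 0 1

theorem expect_C_mul (f : ℕ → ℝ) (a : ℝ) (P : ℝ[X]) : expect f (C a * P) = a * expect f P := by
  rw [← smul_eq_C_mul, map_smul, smul_eq_mul]

theorem expect_X_mul (f : ℕ → ℝ) (P : ℝ[X]) : expect f (X * P) = expect (fun k => f (k + 1)) P := by
  induction P using Polynomial.induction_on' with
  | add P Q hP hQ => rw [mul_add, map_add, map_add, hP, hQ]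
  | monomial k a => rw [X_mul_monomial, expect_monomial, expect_monomial]

theorem expect_X_pow_mul (f : ℕ → ℝ) (l : ℕ) (P : ℝ[X]) :
    expect f (X ^ l * P) = expect (fun k => f (k + l)) P := by
  induction l generalizing f with
  | zero => simp
  | succ l ih => rw [pow_succ', mul_assoc, expect_X_mul, ih]; rfl

theorem expect_add_fun (f g : ℕ → ℝ) (P : ℝ[X]) :
    expect (fun k => f k + g k) P = expect f P + expect g P := by
  simp only [expect_eq_sum_range _ P (Nat.lt_succ_self _), add_mul, Finset.sum_add_distrib]

theorem expect_sub_fun (f g : ℕ → ℝ) (P : ℝ[X]) :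
    expect (fun k => f k - g k) P = expect f P - expect g P := by
  simp only [expect_eq_sum_range _ P (Nat.lt_succ_self _), sub_mul, Finset.sum_sub_distrib]

theorem expect_mono {f g : ℕ → ℝ} (h : ∀ k, f k ≤ g k) {P : ℝ[X]} (hP : ∀ k, 0 ≤ P.coeff k) :
    expect f P ≤ expect g P := by
  simp only [expect_eq_sum_range _ P (Nat.lt_succ_self _)]
  exact Finset.sum_le_sum fun k _ => mul_le_mul_of_nonneg_right (h k) (hP k)

theorem expect_const_one (P : ℝ[X]) : expect (fun _ => 1) P = P.eval 1 := by
  rw [expect_eq_sum_range _ P (Nat.lt_succ_self _), eval_eq_sum_range]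
  simp

theorem expect_ite_eq (P : ℝ[X]) (k : ℕ) :
    expect (fun i => if i = k then 1 else 0) P = P.coeff k := by
  induction P using Polynomial.induction_on' with
  | add P Q hP hQ => rw [map_add, coeff_add, hP, hQ]
  | monomial i a => rw [expect_monomial, coeff_monomial]; simp

/-- The generating polynomial of the Bernoulli law with success probability `q`. -/
noncomputable def bernPoly (q : ℝ) : ℝ[X] := C (1 - q) + C q * X

@[simp] theorem bernPoly_zero : bernPoly 0 = 1 := by simp [bernPoly]

@[simp] theorem bernPoly_one : bernPoly 1 = X := by simp [bernPoly]

@[simp] theorem eval_one_bernPoly (q : ℝ) : (bernPoly q).eval 1 = 1 := by simp [bernPoly]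

theorem natDegree_bernPoly_le (q : ℝ) : (bernPoly q).natDegree ≤ 1 := by
  rw [bernPoly, add_comm]; exact natDegree_linear_le

theorem expect_bernPoly_mul (f : ℕ → ℝ) (q : ℝ) (P : ℝ[X]) :
    expect f (bernPoly q * P) = (1 - q) * expect f P + q * expect (fun k => f (k + 1)) P := by
  rw [bernPoly, add_mul, map_add, mul_assoc, expect_C_mul, expect_C_mul, expect_X_mul]

theorem coeff_bernPoly_mul_nonneg {q : ℝ} (hq : q ∈ Set.Icc (0 : ℝ) 1) {P : ℝ[X]}
    (hP : ∀ k, 0 ≤ P.coeff k) (k : ℕ) : 0 ≤ (bernPoly q * P).coeff k := by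
  have h1 : 0 ≤ 1 - q := by linarith [hq.2]
  rw [bernPoly, add_mul, mul_assoc, coeff_add, coeff_C_mul, coeff_C_mul]
  refine add_nonneg (mul_nonneg h1 (hP k)) (mul_nonneg hq.1 ?_)
  cases k with
  | zero => simp
  | succ k => rw [coeff_X_mul]; exact hP k

theorem coeff_prod_bernPoly_nonneg {ι : Type*} (s : Finset ι) {p : ι → ℝ}
    (hp : ∀ j, p j ∈ Set.Icc (0 : ℝ) 1) (k : ℕ) : 0 ≤ (∏ j ∈ s, bernPoly (p j)).coeff k := by
  classical
  induction s using Finset.induction_on generalizing k with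
  | empty => simp only [Finset.prod_empty, coeff_one]; split_ifs <;> norm_num
  | insert a s ha ih => rw [Finset.prod_insert ha]; exact coeff_bernPoly_mul_nonneg (hp a) ih k

theorem coeff_bernPoly_pow (q : ℝ) (m k : ℕ) :
    (bernPoly q ^ m).coeff k = m.choose k * q ^ k * (1 - q) ^ (m - k) := by
  have h : bernPoly q ^ m =
      ∑ i ∈ Finset.range (m + 1), monomial i (m.choose i * q ^ i * (1 - q) ^ (m - i)) := by
    rw [bernPoly, add_comm, add_pow]
    refine Finset.sum_congr rfl fun i _ => ?_
    rw [← C_mul_X_pow_eq_monomial, mul_pow]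
    simp only [C_mul, C_pow, ← C_eq_natCast]
    ring
  rw [h, finsetSum_coeff]
  simp only [coeff_monomial]
  rw [Finset.sum_ite_eq' ]
  split_ifs with hk
  · rfl
  · rw [Nat.choose_eq_zero_of_lt (by simpa using hk)]; simp

/-- The generating polynomial of the Bernoulli convolution with parameter `p`. -/
noncomputable def chainPoly {ι : Type*} [Fintype ι] (p : ι → ℝ) : ℝ[X] := ∏ j, bernPoly (p j)

theorem eval_one_chainPoly {ι : Type*} [Fintype ι] (p : ι → ℝ) : (chainPoly p).eval 1 = 1 := by
  simp [chainPoly, eval_prod]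

theorem coeff_chainPoly_nonneg {ι : Type*} [Fintype ι] {p : ι → ℝ}
    (hp : ∀ j, p j ∈ Set.Icc (0 : ℝ) 1) (k : ℕ) : 0 ≤ (chainPoly p).coeff k :=
  coeff_prod_bernPoly_nonneg _ hp k

theorem natDegree_chainPoly_le {ι : Type*} [Fintype ι] (p : ι → ℝ) :
    (chainPoly p).natDegree ≤ Fintype.card ι := by
  refine (natDegree_prod_le _ _).trans ((Finset.sum_le_sum fun j _ =>
    natDegree_bernPoly_le (p j)).trans ?_)
  simp

theorem continuous_coeff_prod_bernPoly {ι : Type*} (s : Finset ι) (k : ℕ) :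
    Continuous fun p : ι → ℝ => (∏ j ∈ s, bernPoly (p j)).coeff k := by
  classical
  induction s using Finset.induction_on generalizing k with
  | empty => simp only [Finset.prod_empty]; exact continuous_const
  | insert a s ha ih =>
    simp only [Finset.prod_insert ha, bernPoly, add_mul, mul_assoc, coeff_add, coeff_C_mul]
    simp only [bernPoly] at ih
    cases k with
    | zero =>
      simp only [coeff_X_mul_zero]
      have := ih 0
      fun_prop
    | succ k =>
      simp only [coeff_X_mul]
      have h0 := ih k
      have h1 := ih (k + 1)
      fun_prop

theorem continuous_expect_chainPoly {ι : Type*} [Fintype ι] (f : ℕ → ℝ) :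
    Continuous fun p : ι → ℝ => expect f (chainPoly p) := by
  simp only [fun p : ι → ℝ => expect_eq_sum_range f _
    (Nat.lt_succ_of_le (natDegree_chainPoly_le p))]
  exact continuous_finsetSum _ fun k _ =>
    continuous_const.mul (continuous_coeff_prod_bernPoly _ k)

theorem chainPoly_cons {n : ℕ} (a : ℝ) (p : Fin n → ℝ) :
    chainPoly (Fin.cons a p : Fin (n + 1) → ℝ) = bernPoly a * chainPoly p := by
  simp [chainPoly, Fin.prod_univ_succ]

instance {n : ℕ} (p : Fin n → I) : IsProbabilityMeasure (bernoulliConv p) := by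
  induction n with
  | zero => rw [bernoulliConv]; infer_instance
  | succ n ih =>
    rw [bernoulliConv]
    have := ih (fun j => p j.succ)
    infer_instance

theorem bernoulliConv_real {n : ℕ} (p : Fin n → I) (A : Set ℕ) :
    (bernoulliConv p).real A = expect (A.indicator 1) (chainPoly fun j => (p j : ℝ)) := by
  induction n generalizing A with
  | zero => simp [bernoulliConv, chainPoly, expect_one, measureReal_def, Set.indicator, apply_ite]
  | succ n ih =>
    have hA : MeasurableSet A := .of_discrete
    have e : (chainPoly fun j => (p j : ℝ)) =
        bernPoly (p 0) * chainPoly (fun j : Fin n => (p j.succ : ℝ)) := by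
      simp [chainPoly, Fin.prod_univ_succ]
    have e2 : (fun k => A.indicator (1 : ℕ → ℝ) (k + 1)) =
        ((fun k => 1 + k) ⁻¹' A).indicator 1 := by
      funext k
      have h : (1 + k ∈ A) ↔ k ∈ (fun k => 1 + k) ⁻¹' A := Iff.rfl
      rw [add_comm k 1]
      by_cases hk : 1 + k ∈ A
      · rw [Set.indicator_of_mem hk, Set.indicator_of_mem (h.1 hk)]; rfl
      · rw [Set.indicator_of_notMem hk, Set.indicator_of_notMem (mt h.2 hk)]
    have hsmul (c : NNReal) (μ : Measure ℕ) : c • μ = (c : ENNReal) • μ := rfl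
    rw [e, expect_bernPoly_mul, e2, ← ih, ← ih, bernoulliConv, bernoulliMeasure_def,
      Measure.add_conv, hsmul, hsmul, Measure.conv_smul_left, Measure.conv_smul_left,
      Measure.dirac_conv, Measure.dirac_zero_conv, ← hsmul, ← hsmul, measureReal_add_apply,
      measureReal_nnreal_smul_apply, measureReal_nnreal_smul_apply,
      map_measureReal_apply (by fun_prop) hA, add_comm]
    simp

/-! ### Hoeffding's extremal argument -/

/-- The second forward difference `k ↦ f (k + 2) - 2 * f (k + 1) + f k` of `f`. -/
def secondDiff (f : ℕ → ℝ) (k : ℕ) : ℝ := f (k + 2) - f (k + 1) - (f (k + 1) - f k)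

theorem expect_bernPoly_mul_bernPoly_mul (f : ℕ → ℝ) (a b : ℝ) (P : ℝ[X]) :
    expect f (bernPoly a * (bernPoly b * P)) =
      expect f P + (a + b) * (expect (fun k => f (k + 1)) P - expect f P) +
        a * b * expect (secondDiff f) P := by
  have h : expect (secondDiff f) P = expect (fun k => f (k + 2)) P - expect (fun k => f (k + 1)) P -
      (expect (fun k => f (k + 1)) P - expect f P) := by
    rw [← expect_sub_fun, ← expect_sub_fun, ← expect_sub_fun]; rfl
  rw [h, expect_bernPoly_mul, expect_bernPoly_mul, expect_bernPoly_mul]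
  ring

section

variable {ι : Type*} [DecidableEq ι]

/-- `p` with the entries at `i` and `j` replaced by `a` and `b`. -/
def replacePair (p : ι → ℝ) (i j : ι) (a b : ℝ) : ι → ℝ :=
  Function.update (Function.update p i a) j b

theorem replacePair_left (p : ι → ℝ) {i j : ι} (hij : i ≠ j) (a b : ℝ) :
    replacePair p i j a b i = a := by simp [replacePair, hij]

theorem replacePair_right (p : ι → ℝ) (i j : ι) (a b : ℝ) : replacePair p i j a b j = b := by
  simp [replacePair]

theorem replacePair_mem_Icc {p : ι → ℝ} (hp : ∀ l, p l ∈ Set.Icc (0 : ℝ) 1) {i j : ι} {a b : ℝ}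
    (ha : a ∈ Set.Icc (0 : ℝ) 1) (hb : b ∈ Set.Icc (0 : ℝ) 1) (l : ι) :
    replacePair p i j a b l ∈ Set.Icc (0 : ℝ) 1 := by
  unfold replacePair
  rcases eq_or_ne l j with rfl | hlj
  · simpa using hb
  · rw [Function.update_of_ne hlj]
    rcases eq_or_ne l i with rfl | hli
    · simpa using ha
    · rw [Function.update_of_ne hli]; exact hp l

variable [Fintype ι]

/-- The generating polynomial of the sum of all trials except `i` and `j`. -/
noncomputable def restPoly (p : ι → ℝ) (i j : ι) : ℝ[X] :=
  ∏ l ∈ (Finset.univ.erase i).erase j, bernPoly (p l)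

theorem chainPoly_eq_mul_restPoly (p : ι → ℝ) {i j : ι} (hij : i ≠ j) :
    chainPoly p = bernPoly (p i) * (bernPoly (p j) * restPoly p i j) := by
  rw [chainPoly, restPoly, Finset.mul_prod_erase _ (fun l => bernPoly (p l)) (by simp [hij.symm]),
    Finset.mul_prod_erase _ (fun l => bernPoly (p l)) (Finset.mem_univ i)]

theorem sum_eq_add_sum_rest (g : ι → ℝ) {i j : ι} (hij : i ≠ j) :
    ∑ l, g l = g i + (g j + ∑ l ∈ (Finset.univ.erase i).erase j, g l) := by
  rw [Finset.add_sum_erase _ g (by simp [hij.symm]), Finset.add_sum_erase _ g (Finset.mem_univ i)]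

theorem replacePair_rest (p : ι → ℝ) {i j l : ι} (a b : ℝ)
    (hl : l ∈ (Finset.univ.erase i).erase j) : replacePair p i j a b l = p l := by
  have h : l ≠ j ∧ l ≠ i := by simpa using hl
  simp [replacePair, h.1, h.2]

theorem sum_replacePair (g : ℝ → ℝ) (p : ι → ℝ) {i j : ι} (hij : i ≠ j) (a b : ℝ) :
    ∑ l, g (replacePair p i j a b l) = ∑ l, g (p l) + (g a + g b - g (p i) - g (p j)) := by
  rw [sum_eq_add_sum_rest _ hij, sum_eq_add_sum_rest (fun l => g (p l)) hij,
    replacePair_left p hij, replacePair_right, Finset.sum_congr rfl fun l hl => by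
      rw [replacePair_rest p a b hl]]
  ring

/-- The expectation of `f` is affine in the product of any two entries once their sum is fixed. -/
theorem expect_replacePair (f : ℕ → ℝ) (p : ι → ℝ) {i j : ι} (hij : i ≠ j) {a b : ℝ}
    (hab : a + b = p i + p j) :
    expect f (chainPoly (replacePair p i j a b)) =
      expect f (chainPoly p) + (a * b - p i * p j) * expect (secondDiff f) (restPoly p i j) := by
  have h : restPoly (replacePair p i j a b) i j = restPoly p i j :=
    Finset.prod_congr rfl fun l hl => by rw [replacePair_rest p a b hl]
  rw [chainPoly_eq_mul_restPoly _ hij, chainPoly_eq_mul_restPoly p hij, h,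
    replacePair_left p hij, replacePair_right, expect_bernPoly_mul_bernPoly_mul,
    expect_bernPoly_mul_bernPoly_mul, hab]
  ring

/-- Among the parameters with a given sum that maximize the expectation of `f`, one of minimal sum
of squares has the following property: averaging two distinct entries would strictly decrease the
expectation of `f`. -/
theorem exists_maximizer (f : ℕ → ℝ) {p₀ : ι → ℝ} (hp₀ : ∀ j, p₀ j ∈ Set.Icc (0 : ℝ) 1) :
    ∃ p : ι → ℝ, (∀ j, p j ∈ Set.Icc (0 : ℝ) 1) ∧ ∑ j, p j = ∑ j, p₀ j ∧
      (∀ p' : ι → ℝ, (∀ j, p' j ∈ Set.Icc (0 : ℝ) 1) → ∑ j, p' j = ∑ j, p₀ j →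
        expect f (chainPoly p') ≤ expect f (chainPoly p)) ∧
      ∀ i j, p i ≠ p j → expect (secondDiff f) (restPoly p i j) < 0 := by
  set S : Set (ι → ℝ) := Set.Icc 0 1 ∩ {p | ∑ j, p j = ∑ j, p₀ j} with hS
  have hmem (p : ι → ℝ) : p ∈ S ↔ (∀ j, p j ∈ Set.Icc (0 : ℝ) 1) ∧ ∑ j, p j = ∑ j, p₀ j := by
    simp only [hS, Set.mem_inter_iff, Set.mem_Icc, Pi.le_def, Set.mem_ofPred_eq, forall_and]
    rfl
  have hSc : IsCompact S := isCompact_Icc.inter_right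
    (isClosed_eq (by fun_prop) continuous_const)
  have hF := continuous_expect_chainPoly (ι := ι) f
  obtain ⟨p₁, hp₁, hmax₁⟩ := hSc.exists_isMaxOn ⟨p₀, (hmem p₀).2 ⟨hp₀, rfl⟩⟩ hF.continuousOn
  have hMc : IsCompact (S ∩ {p | expect f (chainPoly p) = expect f (chainPoly p₁)}) :=
    hSc.inter_right (isClosed_eq hF continuous_const)
  obtain ⟨p, ⟨hpS, hpF⟩, hmin⟩ := hMc.exists_isMinOn (f := fun p => ∑ j, p j ^ 2) ⟨p₁, hp₁, rfl⟩
    (by fun_prop)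
  obtain ⟨hp, hsum⟩ := (hmem p).1 hpS
  have hmax : ∀ p' ∈ S, expect f (chainPoly p') ≤ expect f (chainPoly p) := fun p' hp' =>
    (hmax₁ hp').trans_eq (Eq.symm hpF)
  refine ⟨p, hp, hsum, fun p' h1 h2 => hmax p' ((hmem p').2 ⟨h1, h2⟩), fun i j hne => ?_⟩
  have hij : i ≠ j := fun h => hne (by rw [h])
  have hi := hp i
  have hj := hp j
  have hsq : 0 < (p i - p j) ^ 2 := by positivity [sub_ne_zero.2 hne]
  have hc : (p i + p j) / 2 ∈ Set.Icc (0 : ℝ) 1 :=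
    ⟨by linarith [hi.1, hj.1], by linarith [hi.2, hj.2]⟩
  set p' := replacePair p i j ((p i + p j) / 2) ((p i + p j) / 2) with hp'
  have hp'S : p' ∈ S := by
    refine (hmem p').2 ⟨replacePair_mem_Icc hp hc hc, ?_⟩
    rw [← hsum]
    have := sum_replacePair id p hij ((p i + p j) / 2) ((p i + p j) / 2)
    simp only [id] at this
    rw [hp', this]; ring
  have hE := expect_replacePair f p hij (a := (p i + p j) / 2) (b := (p i + p j) / 2) (by ring)
  rw [← hp'] at hE
  have hle := hmax p' hp'S
  by_contra! hD
  -- a nonnegative second difference makes the averaged parameter another maximizer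
  have hprod : 0 ≤ ((p i + p j) / 2 * ((p i + p j) / 2) - p i * p j) *
      expect (secondDiff f) (restPoly p i j) := mul_nonneg (by nlinarith) hD
  have hp'F : expect f (chainPoly p') = expect f (chainPoly p₁) := by
    rw [← show expect f (chainPoly p) = _ from hpF]; linarith
  have h2 : ∑ l, p l ^ 2 ≤ ∑ l, p' l ^ 2 := hmin ⟨hp'S, hp'F⟩
  have h3 := sum_replacePair (fun t => t ^ 2) p hij ((p i + p j) / 2) ((p i + p j) / 2)
  rw [← hp'] at h3
  nlinarith

/-- If every entry is `0`, `1` or `q`, the Bernoulli convolution is a shifted binomial law. -/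
theorem exists_prod_bernPoly_eq {ι : Type*} (s : Finset ι) {p : ι → ℝ} {q : ℝ}
    (hp : ∀ j ∈ s, p j = 0 ∨ p j = 1 ∨ p j = q) :
    ∃ l m : ℕ, l + m ≤ s.card ∧ ∏ j ∈ s, bernPoly (p j) = X ^ l * bernPoly q ^ m ∧
      ∑ j ∈ s, p j = l + m * q := by
  classical
  induction s using Finset.induction_on with
  | empty => exact ⟨0, 0, by simp⟩
  | insert a s ha ih =>
    obtain ⟨l, m, hlm, hP, hsum⟩ := ih fun j hj => hp j (Finset.mem_insert_of_mem hj)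
    rw [Finset.prod_insert ha, Finset.sum_insert ha, Finset.card_insert_of_notMem ha, hP, hsum]
    rcases hp a (Finset.mem_insert_self a s) with h | h | h
    · exact ⟨l, m, by omega, by simp [h], by simp [h]⟩
    · exact ⟨l + 1, m, by omega, by rw [h, bernPoly_one]; ring, by rw [h]; push_cast; ring⟩
    · exact ⟨l, m + 1, by omega, by rw [h]; ring, by rw [h]; push_cast; ring⟩

/-- The maximizer of `exists_maximizer` has at most one value other than `0` and `1`: two distinct
entries of the open unit interval could be moved apart. -/
theorem exists_maximizer_three_values (f : ℕ → ℝ) {p₀ : ι → ℝ}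
    (hp₀ : ∀ j, p₀ j ∈ Set.Icc (0 : ℝ) 1) :
    ∃ (p : ι → ℝ) (q : ℝ), q ∈ Set.Icc (0 : ℝ) 1 ∧ (∀ j, p j = 0 ∨ p j = 1 ∨ p j = q) ∧
      ∑ j, p j = ∑ j, p₀ j ∧ expect f (chainPoly p₀) ≤ expect f (chainPoly p) ∧
      ∀ i j, p i ≠ p j → expect (secondDiff f) (restPoly p i j) < 0 := by
  obtain ⟨p, hp, hsum, hmax, hneg⟩ := exists_maximizer f hp₀
  have key : ∀ i j, p i ∈ Set.Ioo (0 : ℝ) 1 → p j ∈ Set.Ioo (0 : ℝ) 1 → ¬ p i < p j := by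
    intro i j hi hj hlt
    have hij : i ≠ j := fun h => hlt.ne (by rw [h])
    have hD := hneg i j hlt.ne
    obtain ⟨ε, hε, hε1, hε2⟩ : ∃ ε > 0, ε ≤ p i ∧ ε ≤ 1 - p j :=
      ⟨min (p i) (1 - p j), lt_min hi.1 (by linarith [hj.2]), min_le_left _ _, min_le_right _ _⟩
    have hle := hmax (replacePair p i j (p i - ε) (p j + ε))
      (replacePair_mem_Icc hp ⟨by linarith, by linarith [hi.2]⟩
        ⟨by linarith [hj.1], by linarith⟩) (by
          have := sum_replacePair id p hij (p i - ε) (p j + ε)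
          simp only [id] at this
          rw [this, ← hsum]; ring)
    rw [expect_replacePair f p hij (by ring)] at hle
    have : 0 < ((p i - ε) * (p j + ε) - p i * p j) * expect (secondDiff f) (restPoly p i j) :=
      mul_pos_of_neg_of_neg (by nlinarith) hD
    linarith
  by_cases h : ∃ i, p i ∈ Set.Ioo (0 : ℝ) 1
  · obtain ⟨i, hi⟩ := h
    refine ⟨p, p i, hp i, fun j => ?_, hsum, hmax p₀ hp₀ rfl, hneg⟩
    by_contra! hj
    have hj' : p j ∈ Set.Ioo (0 : ℝ) 1 :=
      ⟨lt_of_le_of_ne (hp j).1 hj.1.symm, lt_of_le_of_ne (hp j).2 hj.2.1⟩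
    rcases lt_or_gt_of_ne hj.2.2 with h | h
    exacts [key j i hj' hi h, key i j hi hj' h]
  · refine ⟨p, 0, by simp, fun j => ?_, hsum, hmax p₀ hp₀ rfl, hneg⟩
    by_contra! hj
    exact h ⟨j, lt_of_le_of_ne (hp j).1 hj.1.symm, lt_of_le_of_ne (hp j).2 hj.2.1⟩

end

/-- Hoeffding's theorem on extremal Bernoulli convolutions: for a fixed sum of the success
probabilities, the expectation of `f` is largest under some shifted binomial law. -/
theorem exists_shifted_binomial_ge {ι : Type*} [Fintype ι] (f : ℕ → ℝ) {p : ι → ℝ}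
    (hp : ∀ j, p j ∈ Set.Icc (0 : ℝ) 1) :
    ∃ (l m : ℕ) (q : ℝ), l + m ≤ Fintype.card ι ∧ q ∈ Set.Icc (0 : ℝ) 1 ∧
      ∑ j, p j = l + m * q ∧ expect f (chainPoly p) ≤ expect f (X ^ l * bernPoly q ^ m) := by
  classical
  obtain ⟨p', q, hq, h3, hsum, hle, -⟩ := exists_maximizer_three_values f hp
  obtain ⟨l, m, hlm, hP, hs⟩ := exists_prod_bernPoly_eq Finset.univ fun j _ => h3 j
  exact ⟨l, m, q, hlm, hq, hsum.symm.trans hs, hle.trans_eq (by rw [chainPoly, hP])⟩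

/-- The probability, under the law with generating polynomial `P`, of `{x, x + 1, …}`. -/
noncomputable def tailProb (x : ℕ) (P : ℝ[X]) : ℝ := expect (fun k => if x ≤ k then 1 else 0) P

/-- A shifted binomial law is nonincreasing beyond its mean plus the success probability. -/
theorem coeff_shifted_binomial_succ_le {l m c : ℕ} {q : ℝ} (hq : q ∈ Set.Icc (0 : ℝ) 1)
    (hl : l ≤ c) (h : l + m * q + q ≤ c + 1) :
    (X ^ l * bernPoly q ^ m).coeff (c + 1) ≤ (X ^ l * bernPoly q ^ m).coeff c := by
  obtain ⟨k, rfl⟩ := Nat.exists_eq_add_of_le' hl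
  rw [add_right_comm, coeff_X_pow_mul, coeff_X_pow_mul, coeff_bernPoly_pow, coeff_bernPoly_pow]
  have hq1 : 0 ≤ 1 - q := by linarith [hq.2]
  have hq0 := hq.1
  rcases lt_or_ge k m with hkm | hkm
  · obtain ⟨r, rfl⟩ := Nat.exists_eq_add_of_lt hkm
    have e : ((k + r + 1).choose (k + 1) : ℝ) * (k + 1) = (k + r + 1).choose k * (r + 1) := by
      have := Nat.choose_succ_right_eq (k + r + 1) k
      rw [show k + r + 1 - k = r + 1 by omega] at this
      exact_mod_cast this
    rw [show k + r + 1 - (k + 1) = r by omega, show k + r + 1 - k = r + 1 by omega]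
    refine le_of_mul_le_mul_right ?_ (show (0 : ℝ) < k + 1 by positivity)
    have h2 : ((r : ℝ) + 1) * q ≤ (k + 1) * (1 - q) := by push_cast at h; nlinarith
    have h3 : (0 : ℝ) ≤ (k + r + 1).choose k * q ^ k * (1 - q) ^ r := by positivity
    calc ((k + r + 1).choose (k + 1) : ℝ) * q ^ (k + 1) * (1 - q) ^ r * (k + 1)
        = (((k + r + 1).choose (k + 1) : ℝ) * (k + 1)) * q ^ (k + 1) * (1 - q) ^ r := by ring
      _ = ((k + r + 1).choose k * q ^ k * (1 - q) ^ r) * ((r + 1) * q) := by rw [e]; ring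
      _ ≤ ((k + r + 1).choose k * q ^ k * (1 - q) ^ r) * ((k + 1) * (1 - q)) := by gcongr
      _ = _ := by ring
  · rw [Nat.choose_eq_zero_of_lt (by omega)]
    simp only [Nat.cast_zero, zero_mul]
    positivity

/-- Hoeffding's inequality: above the mean, the tail of a Bernoulli convolution is at most that of
the binomial law with the same number of trials and the same mean. -/
theorem tailProb_chainPoly_le {ι : Type*} [Fintype ι] [Nonempty ι] {p : ι → ℝ}
    (hp : ∀ j, p j ∈ Set.Icc (0 : ℝ) 1) {c : ℕ} (hc : ∑ j, p j ≤ c + 1) :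
    tailProb (c + 2) (chainPoly p) ≤
      tailProb (c + 2) (bernPoly ((∑ j, p j) / Fintype.card ι) ^ Fintype.card ι) := by
  classical
  obtain ⟨p', q, hq, h3, hsum, hle, hneg⟩ :=
    exists_maximizer_three_values (fun k => if c + 2 ≤ k then 1 else 0) hp
  have heq : ∀ i j, p' i = p' j := by
    intro i j
    by_contra hne
    have hij : i ≠ j := fun h => hne (by rw [h])
    refine (hneg i j hne).not_ge ?_
    have hD : secondDiff (fun k => if c + 2 ≤ k then (1 : ℝ) else 0) =
        fun k => (if k = c then 1 else 0) - (if k = c + 1 then 1 else 0) := by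
      funext k
      simp only [secondDiff]
      rcases lt_trichotomy k c with h | rfl | h
      · simp [show ¬ c + 2 ≤ k + 2 by omega, show ¬ c + 2 ≤ k + 1 by omega,
          show ¬ c + 2 ≤ k by omega, show k ≠ c by omega, show k ≠ c + 1 by omega]
      · simp
      · rcases eq_or_ne k (c + 1) with rfl | h'
        · simp
        · simp [show c ≤ k by omega, show c + 2 ≤ k + 1 by omega,
            show c + 2 ≤ k by omega, show k ≠ c by omega, h']
    obtain ⟨l, m, -, hP, hs⟩ := exists_prod_bernPoly_eq ((Finset.univ.erase i).erase j)
      fun j _ => h3 j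
    rw [hD, expect_sub_fun, expect_ite_eq, expect_ite_eq, restPoly, hP, sub_nonneg]
    have htot := sum_eq_add_sum_rest p' hij
    rw [hs, hsum] at htot
    have hmq : 0 ≤ m * q := mul_nonneg (Nat.cast_nonneg m) hq.1
    -- the two removed entries are distinct elements of `{0, 1, q}`
    have hpair : q ≤ p' i + p' j ∧ 0 < p' i + p' j := by
      have := hq.1; have := hq.2
      rcases h3 i with h | h | h <;> rcases h3 j with h' | h' | h' <;> rw [h, h'] at hne ⊢
      · simp at hne
      · constructor <;> linarith
      · exact ⟨by linarith, by have := lt_of_le_of_ne hq.1 hne; linarith⟩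
      · constructor <;> linarith
      · simp at hne
      · constructor <;> linarith
      · exact ⟨by linarith, by have := lt_of_le_of_ne hq.1 (Ne.symm hne); linarith⟩
      · constructor <;> linarith
      · simp at hne
    refine coeff_shifted_binomial_succ_le hq ?_ (by linarith)
    have : (l : ℝ) < (c + 1 : ℕ) := by push_cast; linarith
    exact Nat.lt_succ_iff.1 (by exact_mod_cast this)
  obtain ⟨i⟩ := ‹Nonempty ι›
  have hconst : ∀ j, p' j = (∑ j, p j) / Fintype.card ι := by
    intro j
    have hcard : (Fintype.card ι : ℝ) ≠ 0 := by
      exact_mod_cast (Fintype.card_pos_iff.2 ⟨i⟩).ne'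
    rw [← hsum, Finset.sum_congr rfl fun l _ => heq l j]
    simp [hcard]
  refine hle.trans_eq ?_
  rw [tailProb, chainPoly]
  simp [hconst]

/-! ### Tail probabilities -/

theorem tailProb_zero (P : ℝ[X]) : tailProb 0 P = P.eval 1 := by
  simpa [tailProb] using expect_const_one P

theorem tailProb_X_pow_mul (x l : ℕ) (P : ℝ[X]) : tailProb x (X ^ l * P) = tailProb (x - l) P := by
  simp only [tailProb, expect_X_pow_mul, Nat.sub_le_iff_le_add]

theorem tailProb_eq_add (x : ℕ) (P : ℝ[X]) : tailProb x P = P.coeff x + tailProb (x + 1) P := by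
  rw [← expect_ite_eq P x, tailProb, tailProb, ← expect_add_fun]
  congr 2
  funext k
  rcases lt_trichotomy k x with h | rfl | h
  · simp [show ¬ x ≤ k by omega, show k ≠ x by omega, show ¬ x + 1 ≤ k by omega]
  · simp
  · simp [show x ≤ k by omega, show k ≠ x by omega, show x + 1 ≤ k by omega]

theorem tailProb_anti {P : ℝ[X]} (hP : ∀ k, 0 ≤ P.coeff k) {x y : ℕ} (h : x ≤ y) :
    tailProb y P ≤ tailProb x P := by
  refine expect_mono (fun k => ?_) hP
  split_ifs <;> first | omega | norm_num

theorem tailProb_eq_zero {P : ℝ[X]} {x : ℕ} (h : P.natDegree < x) : tailProb x P = 0 := by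
  rw [tailProb, expect_eq_sum_range _ P h]
  exact Finset.sum_eq_zero fun k hk => by simp [Finset.mem_range.1 hk]

theorem natDegree_bernPoly_pow_le (q : ℝ) (m : ℕ) : (bernPoly q ^ m).natDegree ≤ m :=
  (natDegree_pow_le_of_le m (natDegree_bernPoly_le q)).trans (by simp)

theorem tailProb_bernPoly_pow (y m : ℕ) (t : ℝ) :
    tailProb y (bernPoly t ^ m) =
      (∑ k ∈ Finset.Icc y m, bernsteinPolynomial ℝ m k).eval t := by
  rw [tailProb, expect_eq_sum_range _ _ (Nat.lt_succ_of_le (natDegree_bernPoly_pow_le t m)),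
    eval_finsetSum]
  simp only [ite_mul, one_mul, zero_mul]
  rw [← Finset.sum_filter]
  refine Finset.sum_congr (by ext k; simp; omega) fun k _ => ?_
  rw [coeff_bernPoly_pow]
  simp [bernsteinPolynomial]

theorem binomial_real_Icc (m y : ℕ) (q : I) :
    (binomial m q).real (Set.Icc y m) = tailProb y (bernPoly (q : ℝ) ^ m) := by
  rw [binomial_tail_eq, tailProb_bernPoly_pow]

theorem strictMonoOn_tailProb_bernPoly_pow {y m : ℕ} (hy : 1 ≤ y) (hym : y ≤ m) :
    StrictMonoOn (fun t => tailProb y (bernPoly t ^ m)) (Set.Icc 0 1) := by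
  obtain ⟨y, rfl⟩ := Nat.exists_eq_add_of_le' hy
  obtain ⟨m, rfl⟩ := Nat.exists_eq_add_of_le' (hy.trans hym)
  have hym' : y ≤ m := by omega
  simp only [tailProb_bernPoly_pow]
  refine strictMonoOn_of_deriv_pos (convex_Icc 0 1) (Polynomial.continuous _).continuousOn
    fun t ht => ?_
  rw [interior_Icc] at ht
  have h1 : 0 < 1 - t := by linarith [ht.2]
  have h0 : 0 < t := ht.1
  have hc : 0 < (m.choose y : ℝ) := by exact_mod_cast Nat.choose_pos hym'
  rw [Polynomial.deriv, derivative_tail m y hym']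
  simp only [bernsteinPolynomial, eval_mul, eval_natCast, eval_pow, eval_X, eval_sub, eval_one]
  positivity

/-! ### Clopper-Pearson uprays and the region `optimalUpray` -/

section

variable {β : ℝ}

theorem tailProb_clopperPearsonBound (hβ : β ∈ Set.Ioo (0 : ℝ) 1) {m y : ℕ} (hy : 1 ≤ y)
    (hym : y ≤ m) :
    tailProb y (bernPoly (clopperPearsonBound β m y : ℝ) ^ m) = 1 - β := by
  rw [← binomial_real_Icc, clopperPearsonBound_spec hβ hy hym]

theorem clopperPearsonBound_lt_iff (hβ : β ∈ Set.Ioo (0 : ℝ) 1) {m y : ℕ} (hy : 1 ≤ y)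
    (hym : y ≤ m) {t : ℝ} (ht : t ∈ Set.Icc (0 : ℝ) 1) :
    (clopperPearsonBound β m y : ℝ) < t ↔ 1 - β < tailProb y (bernPoly t ^ m) := by
  rw [← tailProb_clopperPearsonBound hβ hy hym]
  exact ((strictMonoOn_tailProb_bernPoly_pow hy hym).lt_iff_lt
    (clopperPearsonBound β m y).2 ht).symm

theorem clopperPearsonBound_mem_Ioo (hβ : β ∈ Set.Ioo (0 : ℝ) 1) {m y : ℕ} (hy : 1 ≤ y)
    (hym : y ≤ m) : (clopperPearsonBound β m y : ℝ) ∈ Set.Ioo (0 : ℝ) 1 := by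
  have hspec := tailProb_clopperPearsonBound hβ hy hym
  refine ⟨lt_of_le_of_ne (clopperPearsonBound β m y).2.1 fun h => ?_,
    lt_of_le_of_ne (clopperPearsonBound β m y).2.2 fun h => ?_⟩
  · rw [← h, bernPoly_zero, one_pow, tailProb_eq_zero (by simp; omega)] at hspec
    linarith [hβ.2]
  · rw [h, bernPoly_one, ← mul_one (X ^ m), tailProb_X_pow_mul, Nat.sub_eq_zero_of_le hym,
      tailProb_zero, eval_one] at hspec
    linarith [hβ.1]

theorem mem_clopperPearsonUpray (hβ : β ∈ Set.Ioo (0 : ℝ) 1) {m : ℕ} (y : Fin (m + 1)) (t : ℝ) :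
    t ∈ clopperPearsonUpray β m y ↔
      t ∈ Set.Icc (0 : ℝ) 1 ∧ 1 - β < tailProb y (bernPoly t ^ m) := by
  unfold clopperPearsonUpray
  split_ifs with h
  · rw [h, tailProb_zero, eval_pow, eval_one_bernPoly, one_pow]
    exact ⟨fun ht => ⟨ht, by linarith [hβ.1]⟩, And.left⟩
  · have hy : 1 ≤ (y : ℕ) := Nat.one_le_iff_ne_zero.2 h
    have hym : (y : ℕ) ≤ m := Nat.lt_succ_iff.1 y.2
    constructor
    · rintro ⟨h1, h2⟩
      have ht : t ∈ Set.Icc (0 : ℝ) 1 := ⟨(clopperPearsonBound β m y).2.1.trans h1.le, h2⟩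
      exact ⟨ht, (clopperPearsonBound_lt_iff hβ hy hym ht).1 h1⟩
    · rintro ⟨ht, h1⟩
      exact ⟨(clopperPearsonBound_lt_iff hβ hy hym ht).2 h1, ht.2⟩

/-- `s` belongs to `optimalUpray β n x` iff it is the mean of the success probabilities of `l` sure
successes, `m` trials with success probability `t`, and `n - l - m` sure failures, for which the
probability of `{x, …, n}` exceeds `1 - β`. -/
theorem mem_optimalUpray_iff_shifted (hβ : β ∈ Set.Ioo (0 : ℝ) 1) {n : ℕ} (x : Fin (n + 1))
    (s : ℝ) : s ∈ optimalUpray β n x ↔ ∃ (l m : ℕ) (t : ℝ), l ≤ (x : ℕ) ∧ (x : ℕ) ≤ l + m ∧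
      l + m ≤ n ∧
      t ∈ Set.Icc (0 : ℝ) 1 ∧ s = (l + m * t) / n ∧
      1 - β < tailProb x (X ^ l * bernPoly t ^ m) := by
  have hx := x.2
  simp only [optimalUpray, chainRegion, Set.mem_iUnion, Set.mem_image,
    mem_clopperPearsonUpray hβ, tailProb_X_pow_mul]
  constructor
  · rintro ⟨l, hl, m, hm, hmn, t, ⟨ht, htail⟩, rfl⟩
    exact ⟨l, m, t, hl, by omega, by omega, ht, by ring, htail⟩
  · rintro ⟨l, m, t, hl, hm, hmn, ht, rfl, htail⟩
    exact ⟨l, hl, m, by omega, by omega, t, ⟨ht, htail⟩, by ring⟩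

theorem optimalUpray_subset_Icc (hβ : β ∈ Set.Ioo (0 : ℝ) 1) {n : ℕ} (x : Fin (n + 1)) :
    optimalUpray β n x ⊆ Set.Icc 0 1 := by
  intro s hs
  obtain ⟨l, m, t, -, -, hlm, ht, rfl, -⟩ := (mem_optimalUpray_iff_shifted hβ x s).1 hs
  have hlm' : (l : ℝ) + m ≤ n := by exact_mod_cast hlm
  have hmt : (m : ℝ) * t ≤ m := mul_le_of_le_one_right (Nat.cast_nonneg m) ht.2
  have := ht.1
  exact ⟨by positivity, div_le_one_of_le₀ (by linarith) (Nat.cast_nonneg n)⟩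

theorem mem_optimalUpray_of_div_le (hβ : β ∈ Set.Ioo (0 : ℝ) 1) {n : ℕ} (hn : 1 ≤ n)
    (x : Fin (n + 1)) {s : ℝ} (hxs : (x : ℝ) ≤ n * s) (hs : s ≤ 1) : s ∈ optimalUpray β n x := by
  have hx := Nat.lt_succ_iff.1 x.2
  have hn0 : (0 : ℝ) < n := by exact_mod_cast hn
  rw [mem_optimalUpray_iff_shifted hβ]
  have htail (t : ℝ) : 1 - β < tailProb x (X ^ (x : ℕ) * bernPoly t ^ (n - x)) := by
    rw [tailProb_X_pow_mul, Nat.sub_self, tailProb_zero, eval_pow, eval_one_bernPoly, one_pow]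
    linarith [hβ.1]
  rcases hx.eq_or_lt with h | h
  · refine ⟨x, n - x, 0, le_rfl, by omega, by omega, by simp, ?_, htail 0⟩
    rw [h] at hxs ⊢
    have : s = 1 := le_antisymm hs (by nlinarith)
    rw [this]; field_simp; ring
  · have hpos : (0 : ℝ) < n - x := sub_pos.2 (by exact_mod_cast h)
    have hle : (n : ℝ) * s ≤ n := mul_le_of_le_one_right hn0.le hs
    refine ⟨x, n - x, (n * s - x) / (n - x), le_rfl, by omega, by omega,
      ⟨div_nonneg (by linarith) hpos.le, (div_le_one hpos).2 (by linarith)⟩, ?_, htail _⟩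
    rw [Nat.cast_sub hx, mul_div_cancel₀ _ hpos.ne']
    field_simp; ring

/-- The parameter with `l` ones, `m` entries `q` and zeros otherwise has this law and average. -/
theorem exists_param_shifted (q : I) {n l m : ℕ} (h : l + m ≤ n) :
    ∃ p : Fin n → I, chainPoly (fun j => (p j : ℝ)) = X ^ l * bernPoly (q : ℝ) ^ m ∧
      avg p = (l + m * q) / n := by
  suffices H : ∃ p : Fin n → I, chainPoly (fun j => (p j : ℝ)) = X ^ l * bernPoly (q : ℝ) ^ m ∧
      ∑ j, (p j : ℝ) = l + m * q by
    obtain ⟨p, h1, h2⟩ := H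
    exact ⟨p, h1, by rw [avg, h2]; ring⟩
  have hcons {n : ℕ} (a : I) (p : Fin n → I) :
      chainPoly (fun j => ((Fin.cons a p : Fin (n + 1) → I) j : ℝ)) =
        bernPoly a * chainPoly fun j => (p j : ℝ) := by
    simp [chainPoly, Fin.prod_univ_succ]
  induction n generalizing l m with
  | zero =>
    obtain ⟨rfl, rfl⟩ : l = 0 ∧ m = 0 := by omega
    exact ⟨fun _ => 0, by simp [chainPoly]⟩
  | succ n ih =>
    rcases l with _ | l
    · rcases m with _ | m
      · obtain ⟨p, h1, h2⟩ := ih (l := 0) (m := 0) (by omega)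
        refine ⟨Fin.cons 0 p, by rw [hcons, h1]; simp, ?_⟩
        rw [Fin.sum_univ_succ]; simpa using h2
      · obtain ⟨p, h1, h2⟩ := ih (l := 0) (m := m) (by omega)
        refine ⟨Fin.cons q p, by rw [hcons, h1]; ring, ?_⟩
        rw [Fin.sum_univ_succ]; simp only [Fin.cons_zero, Fin.cons_succ, h2]; push_cast; ring
    · obtain ⟨p, h1, h2⟩ := ih (l := l) (m := m) (by omega)
      refine ⟨Fin.cons 1 p, by rw [hcons, h1]; simp; ring, ?_⟩
      rw [Fin.sum_univ_succ]; simp only [Fin.cons_zero, Fin.cons_succ, h2]; push_cast; ring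

/-- `optimalUpray β n x` consists of the averages of the parameters under which the probability of
`{x, …, n}` exceeds `1 - β`. -/
theorem mem_optimalUpray_iff_exists_param (hβ : β ∈ Set.Ioo (0 : ℝ) 1) {n : ℕ} (hn : 1 ≤ n)
    (x : Fin (n + 1)) (s : ℝ) :
    s ∈ optimalUpray β n x ↔
      ∃ p : Fin n → I, avg p = s ∧ 1 - β < tailProb x (chainPoly fun j => (p j : ℝ)) := by
  have hn0 : (0 : ℝ) < n := by exact_mod_cast hn
  constructor
  · rw [mem_optimalUpray_iff_shifted hβ]
    rintro ⟨l, m, t, -, -, hlm, ht, rfl, htail⟩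
    obtain ⟨p, h1, h2⟩ := exists_param_shifted ⟨t, ht⟩ hlm
    exact ⟨p, h2, by rw [h1]; exact htail⟩
  · rintro ⟨p, rfl, htail⟩
    obtain ⟨l, m, q, hlm, hq, hsum, hle⟩ := exists_shifted_binomial_ge
      (fun k => if (x : ℕ) ≤ k then 1 else 0) (fun j => (p j).2)
    rw [Fintype.card_fin] at hlm
    have htail' : 1 - β < tailProb x (X ^ l * bernPoly q ^ m) := htail.trans_le hle
    have hlm' : (l : ℝ) + m ≤ n := by exact_mod_cast hlm
    have hmq : (m : ℝ) * q ≤ m := mul_le_of_le_one_right (Nat.cast_nonneg m) hq.2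
    have hmq0 : 0 ≤ (m : ℝ) * q := mul_nonneg (Nat.cast_nonneg m) hq.1
    have havg : avg p = (l + m * q) / n := by rw [avg, hsum]; ring
    rcases le_or_gt l (x : ℕ) with hlx | hlx
    · refine (mem_optimalUpray_iff_shifted hβ x _).2
        ⟨l, m, q, hlx, ?_, hlm, hq, havg, htail'⟩
      by_contra! hxm
      rw [tailProb_X_pow_mul, tailProb_eq_zero
        ((natDegree_bernPoly_pow_le q m).trans_lt (by omega))] at htail'
      linarith [hβ.2]
    · have : (x : ℝ) ≤ l := by exact_mod_cast hlx.le
      refine mem_optimalUpray_of_div_le hβ hn x ?_ ?_ <;> rw [havg]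
      · rw [mul_div_cancel₀ _ hn0.ne']; linarith
      · exact div_le_one_of_le₀ (by linarith) hn0.le

/-- The lower endpoint of `optimalUpray β n x` is the minimum of finitely many rescaled
Clopper-Pearson bounds; at the corresponding parameter the probability of `{x, …, n}` is exactly
`1 - β`. -/
theorem optimalUpray_eq_Ioc (hβ : β ∈ Set.Ioo (0 : ℝ) 1) {n : ℕ} (hn : 1 ≤ n)
    (x : Fin (n + 1)) (hx : 1 ≤ (x : ℕ)) :
    ∃ (l m : ℕ) (g : ℝ), l < (x : ℕ) ∧ (x : ℕ) ≤ l + m ∧ l + m ≤ n ∧ g ∈ Set.Ioo (0 : ℝ) 1 ∧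
      tailProb x (X ^ l * bernPoly g ^ m) = 1 - β ∧
      optimalUpray β n x = Set.Ioc ((l + m * g) / n) 1 := by
  have hn0 : (0 : ℝ) < n := by exact_mod_cast hn
  have hxn := Nat.lt_succ_iff.1 x.2
  set T := (Finset.range (n + 1) ×ˢ Finset.range (n + 1)).filter
    fun a => a.1 < (x : ℕ) ∧ (x : ℕ) ≤ a.1 + a.2 ∧ a.1 + a.2 ≤ n with hT
  have hmemT (l m : ℕ) : (l, m) ∈ T ↔ l < (x : ℕ) ∧ (x : ℕ) ≤ l + m ∧ l + m ≤ n := by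
    simp only [hT, Finset.mem_filter, Finset.mem_product, Finset.mem_range]
    omega
  set b : ℕ × ℕ → ℝ := fun a => a.1 + a.2 * (clopperPearsonBound β a.2 (x - a.1) : ℝ) with hb
  obtain ⟨⟨l, m⟩, hlm, hmin⟩ := T.exists_min_image b ⟨(0, n), (hmemT 0 n).2 (by omega)⟩
  obtain ⟨hl, hxm, hlmn⟩ := (hmemT l m).1 hlm
  set g : ℝ := (clopperPearsonBound β m (x - l) : ℝ) with hg
  have hy : 1 ≤ x - l := by omega
  have hym : x - l ≤ m := by omega
  have hg01 : g ∈ Set.Ioo (0 : ℝ) 1 := clopperPearsonBound_mem_Ioo hβ hy hym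
  have hm0 : (0 : ℝ) < m := by exact_mod_cast hy.trans hym
  refine ⟨l, m, g, hl, hxm, hlmn, hg01, ?_, ?_⟩
  · rw [tailProb_X_pow_mul]; exact tailProb_clopperPearsonBound hβ hy hym
  ext s
  constructor
  · intro hs
    refine ⟨?_, (optimalUpray_subset_Icc hβ x hs).2⟩
    obtain ⟨l', m', t, hl', hxm', hlm', ht, rfl, htail⟩ :=
      (mem_optimalUpray_iff_shifted hβ x s).1 hs
    refine div_lt_div_of_pos_right ?_ hn0
    rcases hl'.lt_or_eq with h | h
    · rw [tailProb_X_pow_mul, ← clopperPearsonBound_lt_iff hβ (by omega) (by omega) ht] at htail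
      have h1 : b (l, m) ≤ b (l', m') := hmin _ ((hmemT l' m').2 ⟨h, hxm', hlm'⟩)
      have hm'0 : (0 : ℝ) < m' := by exact_mod_cast (show 0 < m' by omega)
      have h2 : (m' : ℝ) * (clopperPearsonBound β m' (x - l') : ℝ) < m' * t :=
        mul_lt_mul_of_pos_left htail hm'0
      simp only [hb] at h1
      linarith
    · -- the pair `(x - 1, 1)` gives a value smaller than `x`
      have h1 : b (l, m) ≤ b (x - 1, 1) := hmin _ ((hmemT _ _).2 (by omega))
      have h2 : (clopperPearsonBound β 1 (x - (x - 1)) : ℝ) < 1 :=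
        (clopperPearsonBound_mem_Ioo hβ (by omega) (by omega)).2
      have h3 : 0 ≤ (m' : ℝ) * t := mul_nonneg (Nat.cast_nonneg _) ht.1
      simp only [hb, Nat.cast_one, one_mul, Nat.cast_sub hx] at h1
      rw [h]
      linarith
  · rintro ⟨h1, h2⟩
    rw [div_lt_iff₀ hn0] at h1
    rcases le_or_gt ((n : ℝ) * s) (l + m) with h | h
    · have hgt : g < (n * s - l) / m := by rw [lt_div_iff₀ hm0]; linarith
      have ht : (n * s - l) / m ∈ Set.Icc (0 : ℝ) 1 :=
        ⟨hg01.1.le.trans hgt.le, (div_le_one hm0).2 (by linarith)⟩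
      refine (mem_optimalUpray_iff_shifted hβ x s).2
        ⟨l, m, (n * s - l) / m, hl.le, hxm, hlmn, ht, ?_, ?_⟩
      · rw [mul_div_cancel₀ _ hm0.ne']; field_simp; ring
      · rw [tailProb_X_pow_mul, ← clopperPearsonBound_lt_iff hβ hy hym ht]
        exact hgt
    · refine mem_optimalUpray_of_div_le hβ hn x (le_trans ?_ h.le) h2
      exact_mod_cast hxm

theorem optimalUpray_zero (hβ : β ∈ Set.Ioo (0 : ℝ) 1) {n : ℕ} (hn : 1 ≤ n)
    (x : Fin (n + 1)) (hx : (x : ℕ) = 0) : optimalUpray β n x = Set.Icc 0 1 := by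
  refine (optimalUpray_subset_Icc hβ x).antisymm fun s hs =>
    mem_optimalUpray_of_div_le hβ hn x ?_ hs.2
  rw [hx, Nat.cast_zero]
  exact mul_nonneg (Nat.cast_nonneg n) hs.1

theorem isUpray_optimalUpray (hβ : β ∈ Set.Ioo (0 : ℝ) 1) {n : ℕ} (hn : 1 ≤ n)
    (x : Fin (n + 1)) : IsUpray (optimalUpray β n x) := by
  refine ⟨optimalUpray_subset_Icc hβ x, fun s hs t ht hst => ?_⟩
  rcases Nat.eq_zero_or_pos (x : ℕ) with hx | hx
  · rw [optimalUpray_zero hβ hn x hx]; exact ht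
  · obtain ⟨l, m, g, -, -, -, -, -, he⟩ := optimalUpray_eq_Ioc hβ hn x hx
    rw [he] at hs ⊢
    exact ⟨hs.1.trans_le hst, ht.2⟩

theorem isStrictlyIsotone_optimalUpray (hβ : β ∈ Set.Ioo (0 : ℝ) 1) {n : ℕ} (hn : 1 ≤ n) :
    IsStrictlyIsotone (optimalUpray β n) := by
  intro x y hxy
  have hxy' : (x : ℕ) < y := hxy
  refine Set.ssubset_iff_exists.2 ⟨fun s hs => ?_, ?_⟩
  · rw [mem_optimalUpray_iff_exists_param hβ hn] at hs ⊢
    obtain ⟨p, hp, htail⟩ := hs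
    exact ⟨p, hp, htail.trans_le (tailProb_anti (coeff_chainPoly_nonneg fun j => (p j).2) hxy'.le)⟩
  · -- the lower endpoint of the smaller upray
    obtain ⟨l, m, g, hl, hm, hlm, hg, htail, he⟩ := optimalUpray_eq_Ioc hβ hn y (by omega)
    refine ⟨(l + m * g) / n, ?_, by rw [he]; simp⟩
    obtain ⟨p, hp, havg⟩ := exists_param_shifted ⟨g, hg.1.le, hg.2.le⟩ hlm
    refine (mem_optimalUpray_iff_exists_param hβ hn x _).2 ⟨p, havg, ?_⟩
    refine lt_of_lt_of_le ?_ (tailProb_anti (coeff_chainPoly_nonneg fun j => (p j).2)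
      (Nat.le_sub_one_of_lt hxy'))
    rw [tailProb_eq_add, Nat.sub_add_cancel (by omega), hp]
    simp only [htail]
    obtain ⟨k, hk⟩ : ∃ k, (y : ℕ) - 1 = k + l := ⟨y - 1 - l, by omega⟩
    rw [hk, coeff_X_pow_mul, coeff_bernPoly_pow]
    have h1 : 0 < 1 - g := by linarith [hg.2]
    have h0 := hg.1
    have hc : 0 < (m.choose k : ℝ) := by exact_mod_cast Nat.choose_pos (by omega)
    have : 0 < m.choose k * g ^ k * (1 - g) ^ (m - k) := by positivity
    linarith

/-! ### Coverage probabilities, optimality and admissibility -/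

theorem coverage_eq_expect {n : ℕ} (K : Fin (n + 1) → Set ℝ) (p : Fin n → I) :
    coverage K p = expect ({k : ℕ | ∃ x : Fin (n + 1), (x : ℕ) = k ∧ avg p ∈ K x}.indicator 1)
      (chainPoly fun j => (p j : ℝ)) := bernoulliConv_real p _

theorem expect_one_sub_tail {n : ℕ} (p : Fin n → I) (x : ℕ) :
    expect (fun k => 1 - if x ≤ k then 1 else 0) (chainPoly fun j => (p j : ℝ)) =
      1 - tailProb x (chainPoly fun j => (p j : ℝ)) := by
  rw [expect_sub_fun, expect_const_one, eval_one_chainPoly, tailProb]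

theorem le_coverage {n : ℕ} {K : Fin (n + 1) → Set ℝ} {p : Fin n → I} {x : ℕ} (hx : x ≤ n + 1)
    (h : ∀ y : Fin (n + 1), (y : ℕ) < x → avg p ∈ K y) :
    1 - tailProb x (chainPoly fun j => (p j : ℝ)) ≤ coverage K p := by
  rw [← expect_one_sub_tail, coverage_eq_expect]
  refine expect_mono (fun k => ?_) (coeff_chainPoly_nonneg fun j => (p j).2)
  split_ifs with hk
  · rw [sub_self]; exact Set.indicator_nonneg (fun _ _ => zero_le_one) k
  · rw [Set.indicator_of_mem]
    · simp
    · exact ⟨⟨k, by omega⟩, rfl, h _ (not_le.1 hk)⟩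

theorem coverage_le {n : ℕ} {K : Fin (n + 1) → Set ℝ} {p : Fin n → I} {x : ℕ}
    (h : ∀ y : Fin (n + 1), x ≤ (y : ℕ) → avg p ∉ K y) :
    coverage K p ≤ 1 - tailProb x (chainPoly fun j => (p j : ℝ)) := by
  rw [← expect_one_sub_tail, coverage_eq_expect]
  refine expect_mono (fun k => ?_) (coeff_chainPoly_nonneg fun j => (p j).2)
  split_ifs with hk
  · rw [Set.indicator_of_notMem]
    · simp
    · rintro ⟨y, rfl, hy⟩
      exact h y hk hy
  · rw [sub_zero]
    exact Set.indicator_le_self' (fun _ _ => zero_le_one) k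

theorem isIsotone_optimalUpray (hβ : β ∈ Set.Ioo (0 : ℝ) 1) {n : ℕ} (hn : 1 ≤ n) :
    IsIsotone (optimalUpray β n) :=
  fun x y hxy => (isStrictlyIsotone_optimalUpray hβ hn x y hxy).subset

theorem isConfidenceUpray_optimalUpray (hβ : β ∈ Set.Ioo (0 : ℝ) 1) {n : ℕ} (hn : 1 ≤ n) :
    IsConfidenceUpray β (optimalUpray β n) := by
  refine ⟨⟨optimalUpray_subset_Icc hβ, fun p => ?_⟩, isUpray_optimalUpray hβ hn⟩
  by_cases hall : ∀ y, avg p ∈ optimalUpray β n y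
  · have h := le_coverage (K := optimalUpray β n) (p := p) le_rfl fun y _ => hall y
    rw [tailProb_eq_zero (Nat.lt_succ_of_le ((natDegree_chainPoly_le _).trans (by simp)))] at h
    linarith [hβ.2]
  · push Not at hall
    obtain ⟨y, hy, hmin⟩ := WellFounded.has_min wellFounded_lt
      {y | avg p ∉ optimalUpray β n y} hall
    have h := le_coverage (K := optimalUpray β n) (p := p) y.2.le fun z hz => by
      by_contra hz'
      exact hmin z hz' hz
    have hle : tailProb y (chainPoly fun j => (p j : ℝ)) ≤ 1 - β := by
      by_contra! hlt
      exact hy ((mem_optimalUpray_iff_exists_param hβ hn y _).2 ⟨p, rfl, hlt⟩)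
    linarith

/-- If the probability of `{x, …, n}` exceeds `1 - β`, then a confidence region has to contain the
average for some observation in `{x, …, n}`. -/
theorem exists_mem_of_mem_optimalUpray (hβ : β ∈ Set.Ioo (0 : ℝ) 1) {n : ℕ} (hn : 1 ≤ n)
    {K : Fin (n + 1) → Set ℝ} (hK : IsConfidenceRegion β K) {x : Fin (n + 1)} {s : ℝ}
    (hs : s ∈ optimalUpray β n x) : ∃ y, x ≤ y ∧ s ∈ K y := by
  obtain ⟨p, rfl, htail⟩ := (mem_optimalUpray_iff_exists_param hβ hn x s).1 hs
  by_contra! h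
  have h1 := coverage_le (K := K) (p := p) (x := x) fun y hy => h y hy
  linarith [hK.2 p]

theorem isOptimalIsotone_optimalUpray (hβ : β ∈ Set.Ioo (0 : ℝ) 1) {n : ℕ} (hn : 1 ≤ n) :
    IsOptimalIsotone β (optimalUpray β n) := by
  refine ⟨isConfidenceUpray_optimalUpray hβ hn, isIsotone_optimalUpray hβ hn,
    fun K hK hiso x s hs => ?_⟩
  obtain ⟨y, hxy, hy⟩ := exists_mem_of_mem_optimalUpray hβ hn hK.1 hs
  rcases hxy.eq_or_lt with rfl | hlt
  exacts [hy, hiso x y hlt hy]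

theorem isAdmissible_optimalUpray (hβ : β ∈ Set.Ioo (0 : ℝ) 1) {n : ℕ} (hn : 1 ≤ n) :
    IsAdmissible β (optimalUpray β n) := by
  refine ⟨isConfidenceUpray_optimalUpray hβ hn, fun K hK hsub => funext fun x =>
    (hsub x).antisymm fun s hs => ?_⟩
  by_contra hsK
  -- a point `t ≤ s` that belongs to `optimalUpray β n x` but to no later value
  obtain ⟨t, hts, htx, hty⟩ : ∃ t ≤ s, t ∈ optimalUpray β n x ∧
      ∀ y, x < y → t ∉ optimalUpray β n y := by
    by_cases hx : (x : ℕ) + 1 < n + 1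
    · obtain ⟨t, ht, ht'⟩ := (Set.ssubset_iff_exists.1
        (isStrictlyIsotone_optimalUpray hβ hn x ⟨x + 1, hx⟩ (Nat.lt_succ_self _))).2
      have hup := isUpray_optimalUpray hβ hn
      have hmem : min s t ∈ optimalUpray β n x := by
        rcases min_choice s t with h | h <;> rw [h] <;> assumption
      refine ⟨min s t, min_le_left _ _, hmem, fun y hy hmy => ht' ?_⟩
      have hty := (hup y).2 _ hmy t ((hup x).1 ht) (min_le_right _ _)
      rcases (show (⟨x + 1, hx⟩ : Fin (n + 1)) ≤ y from hy).eq_or_lt with h | h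
      · rwa [h]
      · exact isIsotone_optimalUpray hβ hn _ _ h hty
    · refine ⟨s, le_rfl, hs, fun y hy => ?_⟩
      have := y.2
      have hy' : (x : ℕ) < y := hy
      omega
  obtain ⟨y, hxy, hy⟩ := exists_mem_of_mem_optimalUpray hβ hn hK.1 htx
  rcases hxy.eq_or_lt with rfl | hlt
  · exact hsK ((hK.2 x).2 t hy s (optimalUpray_subset_Icc hβ x hs) hts)
  · exact hty y hlt (hsub y hy)

theorem isGLB_coverage_optimalUpray (hβ : β ∈ Set.Ioo (0 : ℝ) 1) {n : ℕ} (hn : 1 ≤ n) :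
    IsGLB (Set.range fun p : Fin n → I => coverage (optimalUpray β n) p) β := by
  refine ⟨?_, fun b hb => ?_⟩
  · rintro _ ⟨p, rfl⟩
    exact (isConfidenceUpray_optimalUpray hβ hn).1.2 p
  · -- equality holds at the lower endpoint of `optimalUpray β n 1`
    obtain ⟨l, m, g, -, -, hlm, hg, htail, he⟩ :=
      optimalUpray_eq_Ioc hβ hn ⟨1, by omega⟩ le_rfl
    obtain ⟨p, hp, havg⟩ := exists_param_shifted ⟨g, hg.1.le, hg.2.le⟩ hlm
    refine (hb ⟨p, rfl⟩).trans ((coverage_le (x := 1) fun y hy hmem => ?_).trans_eq ?_)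
    · have h1 : avg p ∈ optimalUpray β n ⟨1, by omega⟩ := by
        rcases (show (⟨1, by omega⟩ : Fin (n + 1)) ≤ y from hy).eq_or_lt with h | h
        · rwa [h]
        · exact isIsotone_optimalUpray hβ hn _ _ h hmem
      rw [he, havg] at h1
      exact lt_irrefl _ h1.1
    · rw [hp]
      simp only [htail]
      ring

theorem optimalUpray_one (hβ : β ∈ Set.Ioo (0 : ℝ) 1) {n : ℕ} (hn : 1 ≤ n)
    (x : Fin (n + 1)) (hx : (x : ℕ) = 1) : optimalUpray β n x = Set.Ioc ((1 - β) / n) 1 := by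
  have hn0 : (0 : ℝ) < n := by exact_mod_cast hn
  have hβ0 := hβ.1
  have htail (m : ℕ) (t : ℝ) : tailProb 1 (bernPoly t ^ m) = 1 - (1 - t) ^ m := by
    have := tailProb_eq_add 0 (bernPoly t ^ m)
    rw [tailProb_zero, coeff_bernPoly_pow, eval_pow, eval_one_bernPoly] at this
    simp at this
    linarith
  ext s
  constructor
  · intro hs
    refine ⟨?_, (optimalUpray_subset_Icc hβ x hs).2⟩
    obtain ⟨l, m, t, hl, -, -, ht, rfl, h⟩ := (mem_optimalUpray_iff_shifted hβ x s).1 hs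
    refine div_lt_div_of_pos_right ?_ hn0
    rcases Nat.eq_zero_or_pos l with rfl | hl
    · rw [tailProb_X_pow_mul, hx, Nat.sub_zero, htail] at h
      have := one_add_mul_le_pow (a := -t) (by linarith [ht.2]) m
      rw [← sub_eq_add_neg] at this
      push_cast
      linarith
    · have : (1 : ℝ) ≤ l := by exact_mod_cast hl
      have := mul_nonneg (Nat.cast_nonneg (α := ℝ) m) ht.1
      linarith
  · rintro ⟨h1, h2⟩
    rw [div_lt_iff₀ hn0] at h1
    rcases le_or_gt 1 ((n : ℝ) * s) with h | h
    · exact mem_optimalUpray_of_div_le hβ hn x (by rw [hx]; simpa using h) h2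
    · refine (mem_optimalUpray_iff_shifted hβ x s).2 ⟨0, 1, n * s, by omega, by omega, by omega,
        ⟨by linarith [hβ.2], h.le⟩, by field_simp; simp, ?_⟩
      rw [tailProb_X_pow_mul, hx, Nat.sub_zero, htail]
      linarith

end

/-! ### Large confidence levels -/

/-- The probability that a binomial variable with integer mean `c + 1` exceeds its mean is
nondecreasing in the number of trials: a sure failure may be added to the trials. -/
theorem tailProb_binomial_integer_mean_mono (c : ℕ) {n N : ℕ} (hc : c + 1 ≤ n) (h : n ≤ N) :
    tailProb (c + 2) (bernPoly ((c + 1 : ℝ) / n) ^ n) ≤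
      tailProb (c + 2) (bernPoly ((c + 1 : ℝ) / N) ^ N) := by
  induction N, h using Nat.le_induction with
  | base => exact le_rfl
  | succ N hN ih =>
    refine ih.trans ?_
    have hN0 : (0 : ℝ) < N := by exact_mod_cast (show 0 < N by omega)
    have hcN : (c + 1 : ℝ) ≤ N := by exact_mod_cast hc.trans hN
    set p : Fin (N + 1) → ℝ := Fin.cons 0 fun _ => (c + 1 : ℝ) / N with hp
    have hsum : ∑ j, p j = c + 1 := by
      rw [Fin.sum_univ_succ]
      simp only [hp, Fin.cons_zero, Fin.cons_succ, Finset.sum_const, Finset.card_univ,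
        Fintype.card_fin, nsmul_eq_mul]
      field_simp
      ring
    have hpI : ∀ j, p j ∈ Set.Icc (0 : ℝ) 1 := by
      intro j
      cases j using Fin.cases with
      | zero => simp [hp]
      | succ j =>
        simp only [hp, Fin.cons_succ]
        exact ⟨by positivity, (div_le_one hN0).2 hcN⟩
    have := tailProb_chainPoly_le hpI (c := c) hsum.le
    rw [hsum, Fintype.card_fin, hp, chainPoly_cons, bernPoly_zero, one_mul] at this
    simpa [chainPoly] using this

theorem eight_div_le_one_sub_inv_pow {N : ℕ} (hN : 3 ≤ N) :
    (8 / 27 : ℝ) ≤ (1 - 1 / N) ^ N := by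
  induction N, hN using Nat.le_induction with
  | base => norm_num
  | succ N hN ih =>
    refine ih.trans ?_
    have hN0 : (3 : ℝ) ≤ N := by exact_mod_cast hN
    -- Bernoulli's inequality for the quotient of two consecutive terms
    have hb := one_add_mul_le_pow (a := (1 : ℝ) / ((N - 1) * (N + 1)))
      (by have : 0 ≤ (1 : ℝ) / ((N - 1) * (N + 1)) := by
            apply div_nonneg <;> nlinarith
          linarith) (N + 1)
    have hx : 0 < (1 : ℝ) - 1 / N := by
      rw [sub_pos, div_lt_one (by linarith)]; linarith
    have e1 : (1 : ℝ) - 1 / ((N + 1 : ℕ) : ℝ) =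
        (1 - 1 / N) * (1 + 1 / ((N - 1) * (N + 1))) := by
      have : (N : ℝ) - 1 ≠ 0 := by linarith
      push_cast
      field_simp
      ring
    have e2 : (1 : ℝ) + (N + 1 : ℕ) * (1 / (((N : ℝ) - 1) * (N + 1))) = (1 - 1 / (N : ℝ))⁻¹ := by
      have : (N : ℝ) - 1 ≠ 0 := by linarith
      push_cast
      field_simp
      ring
    rw [e2] at hb
    rw [e1, mul_pow, pow_succ (1 - 1 / (N : ℝ)) N, mul_assoc]
    refine le_mul_of_one_le_right (by positivity) ?_
    calc (1 : ℝ) = (1 - 1 / (N : ℝ)) * (1 - 1 / (N : ℝ))⁻¹ := (mul_inv_cancel₀ hx.ne').symm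
      _ ≤ _ := mul_le_mul_of_nonneg_left hb hx.le

theorem betaThreshold_eq_add (n : ℕ) : betaThreshold n =
    (bernPoly (1 / n) ^ n).coeff 0 + (bernPoly (1 / n) ^ n).coeff 1 := by
  rw [betaThreshold, Set.insert_eq, measureReal_union (by simp) (by simp),
    binomial_real_singleton, binomial_real_singleton, coeff_bernPoly_pow, coeff_bernPoly_pow]
  simp only [one_div]

theorem betaThreshold_eq (n : ℕ) :
    betaThreshold n = 1 - tailProb 2 (bernPoly (1 / n) ^ n) := by
  have h0 := tailProb_eq_add 0 (bernPoly (1 / (n : ℝ)) ^ n)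
  have h1 := tailProb_eq_add 1 (bernPoly (1 / (n : ℝ)) ^ n)
  rw [tailProb_zero, eval_pow, eval_one_bernPoly, one_pow] at h0
  rw [betaThreshold_eq_add]
  simp only [zero_add, Nat.reduceAdd] at h0 h1
  linarith

/-- `19 / 27`, the value of the distribution function of the binomial law with three trials and mean
`2` at its mean, is a lower bound of `β_n`. -/
theorem nineteen_div_le_betaThreshold {n : ℕ} (hn : 1 ≤ n) : 19 / 27 ≤ betaThreshold n := by
  have hform {n : ℕ} (hn : 1 ≤ n) :
      betaThreshold n = (1 - (n : ℝ)⁻¹) ^ n + (1 - (n : ℝ)⁻¹) ^ (n - 1) := by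
    have hn0 : (n : ℝ) ≠ 0 := by exact_mod_cast (show n ≠ 0 by omega)
    rw [betaThreshold_eq_add, coeff_bernPoly_pow, coeff_bernPoly_pow]
    simp [hn0]
  rcases le_or_gt n 12 with h | h
  · have hmono := tailProb_binomial_integer_mean_mono 0 (by omega) h
    have h12 := hform (n := 12) (by norm_num)
    rw [betaThreshold_eq] at h12 ⊢
    norm_num at h12 hmono ⊢
    linarith
  · have hn0 : (13 : ℝ) ≤ n := by exact_mod_cast h
    have hlower : Real.exp (-1) ≤ (1 - (n : ℝ)⁻¹) ^ (n - 1) := by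
      obtain ⟨k, rfl⟩ := Nat.exists_eq_add_of_le' hn
      have hk : (12 : ℝ) ≤ k := by push_cast at hn0; linarith
      have h1 : (1 - ((k + 1 : ℕ) : ℝ)⁻¹) = (1 + 1 / (k : ℝ))⁻¹ := by
        push_cast; field_simp; ring
      rw [h1, inv_pow, Nat.add_sub_cancel, Real.exp_neg]
      refine inv_anti₀ (by positivity) ?_
      calc (1 + 1 / (k : ℝ)) ^ k ≤ Real.exp (1 / k) ^ k := by
            gcongr; rw [add_comm]; exact Real.add_one_le_exp _
        _ = Real.exp 1 := by
            rw [← Real.exp_nat_mul]; congr 1; field_simp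
    have he : (1 / 2.7183 : ℝ) ≤ Real.exp (-1) := by
      rw [Real.exp_neg, one_div]
      exact inv_anti₀ (Real.exp_pos _) (by linarith [Real.exp_one_lt_d9])
    have hinv : (n : ℝ)⁻¹ ≤ 1 / 13 := by
      rw [inv_le_comm₀ (by linarith) (by norm_num)]; linarith
    have hsplit : (1 - (n : ℝ)⁻¹) ^ n = (1 - (n : ℝ)⁻¹) ^ (n - 1) * (1 - (n : ℝ)⁻¹) := by
      rw [← pow_succ, Nat.sub_add_cancel hn]
    rw [hform hn, hsplit]
    norm_num at he
    nlinarith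

/-- The value at its mean of a binomial distribution function with integer mean `c + 1 < n` is at
most `β_n`. -/
theorem one_sub_betaThreshold_le_tailProb {n c : ℕ} (hc : c + 2 ≤ n) :
    1 - betaThreshold n ≤ tailProb (c + 2) (bernPoly ((c + 1 : ℝ) / n) ^ n) := by
  rcases Nat.eq_zero_or_pos c with rfl | hc0
  · rw [betaThreshold_eq]; simp
  · have hmono := tailProb_binomial_integer_mean_mono c (n := c + 2) (by omega) hc
    -- with `c + 2` trials the tail is a single power
    have hpow : tailProb (c + 2) (bernPoly ((c + 1 : ℝ) / (c + 2 : ℕ)) ^ (c + 2)) =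
        (1 - 1 / ((c + 2 : ℕ) : ℝ)) ^ (c + 2) := by
      rw [tailProb_eq_add, tailProb_eq_zero
        (Nat.lt_succ_of_le (natDegree_bernPoly_pow_le _ _)), coeff_bernPoly_pow]
      have : (c + 1 : ℝ) / (c + 2 : ℕ) = 1 - 1 / ((c + 2 : ℕ) : ℝ) := by
        push_cast; field_simp; ring
      rw [this]
      simp
    have h8 := eight_div_le_one_sub_inv_pow (N := c + 2) (by omega)
    have h19 := nineteen_div_le_betaThreshold (n := n) (by omega)
    linarith

theorem optimalUpray_eq_clopperPearson {β : ℝ} (hβ : β ∈ Set.Ioo (0 : ℝ) 1) {n : ℕ}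
    (hβn : betaThreshold n ≤ β) (x : Fin (n + 1)) (hx : 2 ≤ (x : ℕ)) :
    optimalUpray β n x = Set.Ioc (clopperPearsonBound β n x : ℝ) 1 := by
  have hxn := Nat.lt_succ_iff.1 x.2
  have hn : 1 ≤ n := by omega
  have hn0 : (0 : ℝ) < n := by exact_mod_cast hn
  obtain ⟨c, hc⟩ := Nat.exists_eq_add_of_le' hx
  ext s
  constructor
  · intro hs
    have hs01 := optimalUpray_subset_Icc hβ x hs
    refine ⟨?_, hs01.2⟩
    rw [clopperPearsonBound_lt_iff hβ (by omega) hxn hs01]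
    rcases le_or_gt (n * s) (c + 1) with h | h
    · obtain ⟨p, rfl, htail⟩ := (mem_optimalUpray_iff_exists_param hβ hn x s).1 hs
      have : Nonempty (Fin n) := ⟨⟨0, hn⟩⟩
      have havg : avg p = (∑ j, (p j : ℝ)) / Fintype.card (Fin n) := by
        rw [avg, Fintype.card_fin]; ring
      have hmean : ∑ j, (p j : ℝ) ≤ c + 1 := by
        rw [havg, Fintype.card_fin, mul_div_cancel₀ _ hn0.ne'] at h; exact h
      have hH := tailProb_chainPoly_le (fun j => (p j).2) hmean
      rw [← havg, ← hc, Fintype.card_fin] at hH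
      exact htail.trans_le hH
    · have hlt : (c + 1 : ℝ) / n < s := by rw [div_lt_iff₀ hn0]; linarith
      have hmem : (c + 1 : ℝ) / n ∈ Set.Icc (0 : ℝ) 1 :=
        ⟨by positivity, hlt.le.trans hs01.2⟩
      have h1 := strictMonoOn_tailProb_bernPoly_pow (y := x) (m := n) (by omega) hxn
        hmem hs01 hlt
      have h2 := one_sub_betaThreshold_le_tailProb (n := n) (c := c) (by omega)
      rw [← hc] at h2
      simp only at h1
      linarith
  · intro hs
    have hs01 : s ∈ Set.Icc (0 : ℝ) 1 := ⟨(clopperPearsonBound β n x).2.1.trans hs.1.le, hs.2⟩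
    refine (mem_optimalUpray_iff_shifted hβ x s).2
      ⟨0, n, s, by omega, by omega, by omega, hs01, by field_simp; simp, ?_⟩
    rw [tailProb_X_pow_mul, Nat.sub_zero, ← clopperPearsonBound_lt_iff hβ (by omega) hxn hs01]
    exact hs.1

end BernoulliChain

open BernoulliChain
theorem theorem2 (n : ℕ) (hn : 1 ≤ n) (β : ℝ) (hβ₀ : 0 < β) (hβ₁ : β < 1) :
    IsOptimalIsotone β (optimalUpray β n) ∧
    IsAdmissible β (optimalUpray β n) ∧
    IsStrictlyIsotone (optimalUpray β n) ∧
    IsGLB (Set.range (fun p : Fin n → I => coverage (optimalUpray β n) p)) β ∧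
    (∀ x : Fin (n + 1), (x : ℕ) = 0 → optimalUpray β n x = Set.Icc 0 1) ∧
    (∀ x : Fin (n + 1), (x : ℕ) = 1 → optimalUpray β n x = Set.Ioc ((1 - β) / n) 1) ∧
    (betaThreshold n ≤ β → ∀ x : Fin (n + 1), 2 ≤ (x : ℕ) →
      optimalUpray β n x = Set.Ioc (clopperPearsonBound β n x : ℝ) 1) :=
  have hβ : β ∈ Set.Ioo (0 : ℝ) 1 := ⟨hβ₀, hβ₁⟩
  ⟨isOptimalIsotone_optimalUpray hβ hn, isAdmissible_optimalUpray hβ hn,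
    isStrictlyIsotone_optimalUpray hβ hn, isGLB_coverage_optimalUpray hβ hn,
    optimalUpray_zero hβ hn, optimalUpray_one hβ hn,
    fun h => optimalUpray_eq_clopperPearson hβ h⟩
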